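/- Let $\lambda$ be an infinite cardinal. Then there is a (commutative) Noetherian integral domain of cardinality $\lambda$ whose additive group is a free abelian group. More precisely, call a polynomial with integer coefficients primitive if no integer other than $\pm 1$ divides it; in particular $0$ is not primitive. For a set $X$ of variables let $\mathbb{Q}(X)$ be the field of fractions of the polynomial ring $\mathbb{Z}[X]$, and let $$R_X=\{\,p/q : p,q\in\mathbb{Z}[X],\ q \text{ primitive}\,\},$$ which is a subring of $\mathbb{Q}(X)$. If $|X|=\lambda$, then $R_X$ is a Noetherian integral domain of cardinality $\lambda$, and its additive group is a free abelian group. -/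

import Mathlib

universe u

namespace NoetherianFree

/-- A polynomial with integer coefficients is primitive if the only integers dividing it are the
units `1` and `-1`. In particular the zero polynomial is not primitive. -/
def IsPrimitive {X : Type*} (q : MvPolynomial X ℤ) : Prop :=
  ∀ n : ℤ, MvPolynomial.C n ∣ q → IsUnit n

theorem IsPrimitive.one {X : Type*} : IsPrimitive (1 : MvPolynomial X ℤ) := by
  intro n hn
  have h : IsUnit (MvPolynomial.C n : MvPolynomial X ℤ) := isUnit_of_dvd_one hn
  have h' := h.map (MvPolynomial.constantCoeff : MvPolynomial X ℤ →+* ℤ)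
  simpa using h'

theorem IsPrimitive.ne_zero {X : Type*} {q : MvPolynomial X ℤ} (hq : IsPrimitive q) : q ≠ 0 := by
  rintro rfl
  have h := hq 0 (dvd_zero _)
  simp at h

/-- Gauss's lemma: the product of two primitive polynomials is primitive. -/
theorem IsPrimitive.mul {X : Type*} {q r : MvPolynomial X ℤ} (hq : IsPrimitive q)
    (hr : IsPrimitive r) : IsPrimitive (q * r) := by
  intro n hn
  by_contra hu
  have hn0 : n ≠ 0 := by
    rintro rfl
    rw [map_zero, zero_dvd_iff] at hn
    exact mul_ne_zero hq.ne_zero hr.ne_zero hn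
  obtain ⟨p, hp, hpn⟩ := WfDvdMonoid.exists_irreducible_factor hu hn0
  have hP : Prime (MvPolynomial.C p : MvPolynomial X ℤ) :=
    (MvPolynomial.prime_C_iff X).2 hp.prime
  have hd : (MvPolynomial.C p : MvPolynomial X ℤ) ∣ q * r :=
    (map_dvd MvPolynomial.C hpn).trans hn
  rcases hP.dvd_or_dvd hd with h | h
  · exact hp.not_isUnit (hq p h)
  · exact hp.not_isUnit (hr p h)

/-- The field of rational functions in the set of variables `X`: the field of quotients of the
polynomial ring `ℤ[X]`. -/
abbrev RatFunField (X : Type*) : Type _ := FractionRing (MvPolynomial X ℤ)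

theorem IsPrimitive.map_ne_zero {X : Type*} {q : MvPolynomial X ℤ} (hq : IsPrimitive q) :
    algebraMap (MvPolynomial X ℤ) (RatFunField X) q ≠ 0 := by
  intro h
  exact hq.ne_zero ((IsFractionRing.injective (MvPolynomial X ℤ) (RatFunField X))
    (h.trans (map_zero _).symm))

/-- The ring `R_X`: the subring of the field of rational functions that consists of the fractions
`p / q` with `p`, `q` in `ℤ[X]` and `q` primitive. -/
noncomputable def RX (X : Type*) : Subring (RatFunField X) where
  carrier := {f | ∃ p q : MvPolynomial X ℤ, IsPrimitive q ∧
    f = algebraMap (MvPolynomial X ℤ) (RatFunField X) p /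
        algebraMap (MvPolynomial X ℤ) (RatFunField X) q}
  zero_mem' := ⟨0, 1, IsPrimitive.one, by simp⟩
  one_mem' := ⟨1, 1, IsPrimitive.one, by simp⟩
  mul_mem' := by
    rintro _ _ ⟨p, q, hq, rfl⟩ ⟨p', q', hq', rfl⟩
    exact ⟨p * p', q * q', hq.mul hq', by rw [map_mul, map_mul, div_mul_div_comm]⟩
  add_mem' := by
    rintro _ _ ⟨p, q, hq, rfl⟩ ⟨p', q', hq', rfl⟩
    exact ⟨p * q' + q * p', q * q', hq.mul hq', by
      rw [map_add, map_mul, map_mul, map_mul, div_add_div _ _ hq.map_ne_zero hq'.map_ne_zero]⟩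
  neg_mem' := by
    rintro _ ⟨p, q, hq, rfl⟩
    exact ⟨-p, q, hq, by rw [map_neg, neg_div]⟩

end NoetherianFree

/-! Splitting off the content of a numerator writes every nonzero element of `RX X` as an integer
times a unit. So each ideal is generated by an integer, and the ring is Noetherian.

Freeness is the hard part. Filter the group by A_S = `varSubmodule S` for finite sets S of
variables. By `free_of_wellFounded_filtration` it is enough to find in each A_S a free subgroup C_S
that together with the smaller A_T spans A_S, and that meets a finite sum of A_T trivially when no T
contains S. Such a C_S comes from the mixed difference `mixedDiff`, which exchanges the variables of
S for fresh ones. Its image on A_S is a countable subgroup of `RX X`, hence free by Pontryagin's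
criterion, so A_S splits over the kernel.

The crux is `mem_iSup_of_mixedDiff_eq_zero`: the kernel on A_S is the sum of the A_{S \ {x}}, x in
S. Up to an integer factor this follows by taking constant Laurent coefficients in the fresh
variables. The factor is removed by purity of that sum (`mem_iSup_of_smul_mem`), where constant
coefficients are used again, now modulo p. The kernel is thus independent of the choice of fresh
variables. Choosing them outside any given finite family of sets T yields the required disjointness.
-/

namespace NoetherianFree

/-! ### Freeness from filtrations, and Pontryagin's criterion. -/

section Filtration

/-- Well-founded induction shows that the `C i` span, and `hdisj` makes them independent, so bases
of the `C i` combine to a basis of `M`. The order is only partial: disjointness is required from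
every `A j` with `j` not above `i`, not just from smaller ones. -/
theorem free_of_wellFounded_filtration {R I M : Type*} [Ring R] [PartialOrder I] [WellFoundedLT I]
    [AddCommGroup M] [Module R M] (A C : I → Submodule R M) (hCA : ∀ i, C i ≤ A i)
    (hA : ∀ i, A i ≤ (⨆ j < i, A j) ⊔ C i) (hfree : ∀ i, Module.Free R (C i))
    (hdisj : ∀ i (s : Finset I), (∀ j ∈ s, ¬ i ≤ j) → Disjoint (C i) (⨆ j ∈ s, A j))
    (htop : ⨆ i, A i = ⊤) : Module.Free R M := by
  classical
  have hle : ∀ i, A i ≤ ⨆ j, C j := by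
    intro i
    induction i using WellFoundedLT.induction with
    | ind i ih =>
      exact (hA i).trans (sup_le (iSup₂_le ih) (le_iSup C i))
  have hC : ⨆ i, C i = ⊤ := top_le_iff.1 (htop ▸ iSup_le hle)
  have hind : iSupIndep C := by
    rw [iSupIndep_iff_finsetSum_eq_zero_imp_eq_zero]
    intro s v hv hsum
    by_contra! hne
    obtain ⟨i₀, hi₀, hne₀⟩ := hne
    -- At a maximal index of the support no other support index lies above it, so `hdisj` applies to
    -- all remaining terms.
    obtain ⟨i, hi⟩ := (s.filter fun j => v j ≠ 0).exists_maximal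
      ⟨i₀, Finset.mem_filter.2 ⟨hi₀, hne₀⟩⟩
    have him := Finset.mem_filter.1 hi.1
    have hd := hdisj i ((s.filter fun j => v j ≠ 0).erase i) (by
      intro j hj hij
      exact (Finset.ne_of_mem_erase hj) (le_antisymm (hi.2 (Finset.mem_of_mem_erase hj) hij) hij))
    refine him.2 (Submodule.disjoint_def.1 hd (v i) (hv i him.1) ?_)
    have hs : v i + ∑ j ∈ (s.filter fun j => v j ≠ 0).erase i, v j = 0 := by
      rw [Finset.add_sum_erase _ _ hi.1, Finset.sum_filter_ne_zero, hsum]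
    rw [eq_neg_of_add_eq_zero_left hs]
    refine neg_mem (Submodule.sum_mem _ fun j hj => ?_)
    exact Submodule.mem_iSup_of_mem j (Submodule.mem_iSup_of_mem hj
      (hCA j (hv j (Finset.mem_filter.1 (Finset.mem_of_mem_erase hj)).1)))
  have hint := DirectSum.isInternal_submodule_of_iSupIndep_of_iSup_eq_top hind hC
  exact Module.Free.of_basis (hint.collectedBasis fun i => Module.Free.chooseBasis R (C i))

/-- A submodule mapped onto a free module by `D` splits as its intersection with the kernel and
a free complement. -/
theorem exists_free_complement_ker {R M V : Type*} [Ring R] [AddCommGroup M] [Module R M]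
    [AddCommGroup V] [Module R V] (A : Submodule R M) (D : M →ₗ[R] V)
    (h : Module.Free R (A.map D)) :
    ∃ C ≤ A, Module.Free R C ∧ Disjoint C (LinearMap.ker D) ∧ A ≤ (A ⊓ LinearMap.ker D) ⊔ C := by
  obtain ⟨s, hs⟩ := Module.projective_lifting_property (D.submoduleMap A) LinearMap.id
    (D.submoduleMap_surjective A)
  have hs' : ∀ y, D (s y) = y := fun y => congrArg Subtype.val (LinearMap.congr_fun hs y)
  have hinj : Function.Injective (A.subtype ∘ₗ s) := by
    intro y z hyz
    have : (s y : M) = s z := hyz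
    exact Subtype.ext (by rw [← hs' y, ← hs' z, this])
  refine ⟨LinearMap.range (A.subtype ∘ₗ s), ?_, ?_, ?_, ?_⟩
  · rintro _ ⟨y, rfl⟩
    exact (s y).2
  · exact Module.Free.of_equiv (LinearEquiv.ofInjective _ hinj)
  · rw [Submodule.disjoint_def]
    rintro _ ⟨y, rfl⟩ hy
    have : y = 0 := Subtype.ext ((hs' y).symm.trans hy)
    simp [this]
  · intro f hf
    let y : A.map D := ⟨D f, Submodule.mem_map_of_mem hf⟩
    have hy : D f = D (s y) := (hs' y).symm
    refine Submodule.mem_sup.2 ⟨f - s y, ⟨sub_mem hf (s y).2, ?_⟩, s y, ⟨y, rfl⟩, sub_add_cancel _ _⟩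
    simp [hy]

/-- **Pontryagin's criterion**: a countable abelian group is free if each finitely generated
subgroup lies in a finitely generated pure subgroup. -/
theorem free_of_countable_of_exists_pure {G : Type*} [AddCommGroup G] [Countable G]
    [Module.IsTorsionFree ℤ G]
    (h : ∀ P : Submodule ℤ G, P.FG → ∃ Q : Submodule ℤ G, P ≤ Q ∧ Q.FG ∧
      ∀ (n : ℤ) (g : G), n ≠ 0 → n • g ∈ Q → g ∈ Q) : Module.Free ℤ G := by
  obtain ⟨e, he⟩ := exists_surjective_nat G
  choose Q hPQ hFG hpure using h
  let next : ℕ → {P : Submodule ℤ G // P.FG} → {P : Submodule ℤ G // P.FG} := fun n P =>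
    ⟨Q (P.1 ⊔ ℤ ∙ e n) (P.2.sup (Submodule.fg_span_singleton _)), hFG _ _⟩
  let A' : ℕ → {P : Submodule ℤ G // P.FG} := fun n =>
    Nat.rec ⟨⊥, Submodule.fg_bot⟩ next n
  let A : ℕ → Submodule ℤ G := fun n => (A' n).1
  have hstep : ∀ n, A n ⊔ ℤ ∙ e n ≤ A (n + 1) := fun n => hPQ _ _
  have hmono : Monotone A := monotone_nat_of_le_succ fun n => le_sup_left.trans (hstep n)
  have hAfg : ∀ n, (A n).FG := fun n => (A' n).2
  have hAp : ∀ n (m : ℤ) (g : G), m ≠ 0 → m • g ∈ A n → g ∈ A n := by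
    intro n
    cases n with
    | zero => exact fun m g hm hg => (smul_eq_zero.1 ((Submodule.mem_bot ℤ).1 hg)).resolve_left hm
    | succ n => exact hpure _ _
  -- Purity of `B` makes the quotient torsion-free, and a finitely generated torsion-free group is
  -- free.
  have htf : ∀ (n : ℕ) (B : Submodule ℤ G), (∀ (m : ℤ) (g : G), m ≠ 0 → m • g ∈ B → g ∈ B) →
      Module.Free ℤ ((A n).map B.mkQ) := by
    intro n B hB
    have : Module.Finite ℤ ((A n).map B.mkQ) := Module.Finite.iff_fg.2 ((hAfg n).map _)
    have : Module.IsTorsionFree ℤ (G ⧸ B) := by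
      rw [Module.isTorsionFree_iff_smul_eq_zero]
      intro m x hmx
      obtain ⟨g, rfl⟩ := B.mkQ_surjective x
      by_cases hm : m = 0
      · exact Or.inl hm
      · refine Or.inr ((Submodule.Quotient.mk_eq_zero B).2 (hB m g hm ?_))
        exact (Submodule.Quotient.mk_eq_zero B).1 hmx
    infer_instance
  -- For `n = 0` truncated subtraction gives `A 0`, which is `⊥`, as is the empty supremum.
  have hlt : ∀ n, ⨆ j < n, A j = A (n - 1) := by
    intro n
    cases n with
    | zero => simp [A, A']
    | succ n =>
      exact le_antisymm (iSup₂_le fun j hj => hmono (Nat.lt_succ_iff.1 hj))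
        (le_iSup₂_of_le n n.lt_succ_self le_rfl)
  choose C hCA hCfree hCdisj hCsup using fun n =>
    exists_free_complement_ker (A n) (A (n - 1)).mkQ (htf n _ (hAp _))
  simp only [Submodule.ker_mkQ] at hCdisj hCsup
  refine free_of_wellFounded_filtration A C hCA (fun n => ?_) hCfree (fun n s hs => ?_) ?_
  · rw [hlt]
    exact (hCsup n).trans (sup_le_sup_right inf_le_right _)
  · refine (hCdisj n).mono_right (iSup₂_le fun j hj => hmono ?_)
    have := hs j hj
    omega
  · refine top_le_iff.1 fun g _ => ?_
    obtain ⟨n, rfl⟩ := he g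
    exact Submodule.mem_iSup_of_mem (n + 1)
      (hstep n (Submodule.mem_sup_right (Submodule.mem_span_singleton_self _)))

end Filtration

/-! ### Contents and primitive parts. -/

section Content

variable {X : Type*}

theorem exists_eq_C_mul_isPrimitive {a : MvPolynomial X ℤ} (ha : a ≠ 0) :
    ∃ (n : ℤ) (b : MvPolynomial X ℤ), n ≠ 0 ∧ IsPrimitive b ∧ a = MvPolynomial.C n * b := by
  set n := a.support.gcd fun m => a.coeff m with hn
  have hdvd : MvPolynomial.C n ∣ a := by
    rw [MvPolynomial.C_dvd_iff_dvd_coeff]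
    intro m
    by_cases hm : m ∈ a.support
    · exact Finset.gcd_dvd hm
    · simp [MvPolynomial.notMem_support_iff.1 hm]
  obtain ⟨b, hb⟩ := hdvd
  have hn0 : n ≠ 0 := by
    intro h0
    rw [h0, map_zero, zero_mul] at hb
    exact ha hb
  refine ⟨n, b, hn0, fun m hm => ?_, hb⟩
  have h1 : MvPolynomial.C (n * m) ∣ a := by
    rw [hb, map_mul]
    exact mul_dvd_mul_left _ hm
  have h2 : n * m ∣ n :=
    Finset.dvd_gcd fun i _ => (MvPolynomial.C_dvd_iff_dvd_coeff _ _).1 h1 i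
  exact isUnit_of_dvd_one ((mul_dvd_mul_iff_left hn0).1 (by simpa using h2))

theorem IsPrimitive.not_C_dvd {q : MvPolynomial X ℤ} (hq : IsPrimitive q) {p : ℤ} (hp : Prime p) :
    ¬ MvPolynomial.C p ∣ q := fun h => hp.not_isUnit (hq p h)

/-- The primes of `n` stay prime as constants and none divides `b`, so they can be cancelled from
`w` one at a time. -/
theorem IsPrimitive.C_dvd_of_dvd_mul {b : MvPolynomial X ℤ} (hb : IsPrimitive b) (n : ℤ)
    (hn : n ≠ 0) : ∀ w : MvPolynomial X ℤ, MvPolynomial.C n ∣ w * b → MvPolynomial.C n ∣ w := by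
  induction n using UniqueFactorizationMonoid.induction_on_prime with
  | h₁ => exact absurd rfl hn
  | h₂ n hu => exact fun w _ => (hu.map MvPolynomial.C).dvd
  | h₃ n p hn0 hp ih =>
    intro w hw
    have hP : Prime (MvPolynomial.C p : MvPolynomial X ℤ) := (MvPolynomial.prime_C_iff X).2 hp
    rw [map_mul] at hw ⊢
    obtain ⟨w', rfl⟩ := (hP.dvd_or_dvd ((dvd_mul_right _ _).trans hw)).resolve_right
      (hb.not_C_dvd hp)
    rw [mul_assoc] at hw
    exact mul_dvd_mul_left _ (ih hn0 _ ((mul_dvd_mul_iff_left hP.ne_zero).1 hw))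

theorem mem_supported_of_C_mul_mem {T : Set X} {n : ℤ} (hn : n ≠ 0) {b : MvPolynomial X ℤ}
    (h : MvPolynomial.C n * b ∈ MvPolynomial.supported ℤ T) : b ∈ MvPolynomial.supported ℤ T := by
  rw [MvPolynomial.mem_supported] at h ⊢
  intro x hx
  refine h ?_
  obtain ⟨d, hd, hxd⟩ := (MvPolynomial.mem_vars_iff_mem_support _).1 (Finset.mem_coe.1 hx)
  refine Finset.mem_coe.2 ((MvPolynomial.mem_vars_iff_mem_support _).2 ⟨d, ?_, hxd⟩)
  rw [MvPolynomial.mem_support_iff] at hd ⊢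
  rw [MvPolynomial.coeff_C_mul]
  exact mul_ne_zero hn hd

theorem IsPrimitive.rename {Y : Type*} (e : X ≃ Y) {q : MvPolynomial X ℤ} (hq : IsPrimitive q) :
    IsPrimitive (MvPolynomial.rename e q) := by
  intro n hn
  refine hq n ?_
  have := map_dvd (MvPolynomial.rename e.symm) hn
  simpa [MvPolynomial.rename_rename] using this

end Content

/-! ### Ideals, cardinality and countable subgroups of `R_X`. -/

section Ring

variable {X : Type u}

local notation "ι" => algebraMap (MvPolynomial X ℤ) (RatFunField X)

theorem mem_RX {f : RatFunField X} : f ∈ RX X ↔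
    ∃ p q : MvPolynomial X ℤ, IsPrimitive q ∧ f = ι p / ι q := Iff.rfl

theorem exists_eq_intCast_mul_unit {f : RX X} (hf : f ≠ 0) :
    ∃ (n : ℤ) (v : (RX X)ˣ), f = (n : RX X) * v := by
  obtain ⟨p, q, hq, h⟩ := mem_RX.1 f.2
  have hp : p ≠ 0 := by
    rintro rfl
    exact hf (Subtype.ext (by simpa using h))
  obtain ⟨n, b, -, hb, rfl⟩ := exists_eq_C_mul_isPrimitive hp
  have hb0 := hb.map_ne_zero
  have hq0 := hq.map_ne_zero
  refine ⟨n, ⟨⟨ι b / ι q, b, q, hq, rfl⟩, ⟨ι q / ι b, q, b, hb, rfl⟩, ?_, ?_⟩, ?_⟩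
  · exact Subtype.ext (by simp [hb0, hq0])
  · exact Subtype.ext (by simp [hb0, hq0])
  · refine Subtype.ext (h.trans ?_)
    simp [mul_div_assoc]

theorem isNoetherianRing_RX : IsNoetherianRing (RX X) := by
  have : IsPrincipalIdealRing (RX X) := by
    refine ⟨fun I => ?_⟩
    -- Up to units `I` consists of integers, so a generator of its contraction to ℤ generates `I`.
    obtain ⟨n, hn⟩ := (IsPrincipalIdealRing.principal (I.comap (Int.castRingHom (RX X)))).principal
    refine ⟨(n : RX X), le_antisymm (fun f hf => ?_) ?_⟩
    · rcases eq_or_ne f 0 with rfl | h0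
      · exact zero_mem _
      obtain ⟨m, v, rfl⟩ := exists_eq_intCast_mul_unit h0
      have hm : m ∈ I.comap (Int.castRingHom (RX X)) := by
        rw [Ideal.mem_comap]
        simpa [mul_assoc] using I.mul_mem_right (↑v⁻¹ : RX X) hf
      rw [hn] at hm
      obtain ⟨k, rfl⟩ := Submodule.mem_span_singleton.1 hm
      refine Submodule.mem_span_singleton.2 ⟨k * v, ?_⟩
      simp only [smul_eq_mul]
      push_cast
      ring
    · rw [Submodule.span_singleton_le_iff_mem]
      have : n ∈ I.comap (Int.castRingHom (RX X)) := by
        rw [hn]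
        exact Submodule.mem_span_singleton_self n
      simpa using this
  infer_instance

theorem mk_RX [Infinite X] : Cardinal.mk (RX X) = Cardinal.mk X := by
  have hX : Cardinal.aleph0 ≤ Cardinal.mk X := Cardinal.aleph0_le_mk X
  apply le_antisymm
  · calc Cardinal.mk (RX X) ≤ Cardinal.mk (RatFunField X) := Cardinal.mk_subtype_le _
      _ = Cardinal.mk (MvPolynomial X ℤ) := IsFractionRing.cardinalMk (R := MvPolynomial X ℤ) _
      _ ≤ Cardinal.mk X := by
        rw [MvPolynomial.cardinalMk_eq_max_lift]
        simp [hX]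
  · refine Cardinal.mk_le_of_injective (f := fun x : X =>
      (⟨ι (MvPolynomial.X x), MvPolynomial.X x, 1, IsPrimitive.one, by simp⟩ : RX X)) ?_
    intro x y hxy
    exact MvPolynomial.X_injective
      (IsFractionRing.injective (MvPolynomial X ℤ) (RatFunField X) (congrArg Subtype.val hxy))

/-- If a polynomial `q` clears the denominator of a nonzero integer multiple
of an element of `R_X`, then it clears the denominator of the element itself. -/
theorem exists_mul_eq_of_smul_mul_eq {q w : MvPolynomial X ℤ} {g : RatFunField X} (hg : g ∈ RX X)
    {n : ℤ} (hn : n ≠ 0) (h : n • (ι q * g) = ι w) :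
    ∃ v, w = MvPolynomial.C n * v ∧ ι q * g = ι v := by
  obtain ⟨a, b, hb, rfl⟩ := hg
  have hb0 := hb.map_ne_zero
  have hι := IsFractionRing.injective (MvPolynomial X ℤ) (RatFunField X)
  have hC : ι (MvPolynomial.C n) = (n : RatFunField X) := by simp
  have hn' : (n : RatFunField X) ≠ 0 := by
    rw [← hC]
    exact fun h0 => hn (by simpa using hι (h0.trans (map_zero _).symm))
  have h1 : w * b = MvPolynomial.C n * (q * a) := by
    apply hι
    rw [map_mul, map_mul, map_mul, hC, ← h, zsmul_eq_mul]
    field_simp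
  obtain ⟨v, rfl⟩ := hb.C_dvd_of_dvd_mul n hn w ⟨_, h1⟩
  refine ⟨v, rfl, mul_left_cancel₀ hn' ?_⟩
  rw [← zsmul_eq_mul, h, map_mul, hC]

theorem exists_common_denominator {N : Type*} {φ : N → RatFunField X} (s : Finset N)
    (h : ∀ f, φ f ∈ RX X) :
    ∃ q : MvPolynomial X ℤ, IsPrimitive q ∧ ∀ f ∈ s, ∃ a, ι q * φ f = ι a := by
  classical
  induction s using Finset.induction_on with
  | empty => exact ⟨1, IsPrimitive.one, by simp⟩
  | insert g s _ ih =>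
    obtain ⟨q, hq, hs⟩ := ih
    obtain ⟨c, b, hb, hg⟩ := h g
    have hb0 := hb.map_ne_zero
    refine ⟨q * b, hq.mul hb, fun f hf => ?_⟩
    rcases Finset.mem_insert.1 hf with rfl | hf
    · refine ⟨q * c, ?_⟩
      rw [hg, map_mul, map_mul]
      field_simp
    · obtain ⟨a, ha⟩ := hs f hf
      refine ⟨b * a, ?_⟩
      rw [map_mul, map_mul, ← ha]
      ring

/-- The fractions with a given primitive denominator. -/
noncomputable def divLinear (q : MvPolynomial X ℤ) (hq : IsPrimitive q) :
    MvPolynomial X ℤ →ₗ[ℤ] RX X where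
  toFun w := ⟨ι w / ι q, w, q, hq, rfl⟩
  map_add' v w := Subtype.ext (by simp [add_div])
  map_smul' n w := Subtype.ext (by simp [mul_div_assoc])

instance : CharZero (RX X) :=
  ⟨fun m n h => by simpa using congrArg (Subtype.val : RX X → RatFunField X) h⟩

/-- Finitely many elements have a common primitive denominator `q`. The fractions over `q` whose
numerators use only the monomials that occur form a finitely generated group. It is pure because
dividing a numerator by an integer adds no monomials and, `q` being fixed, no denominator. -/
theorem free_of_countable_submodule (N : Submodule ℤ (RX X)) [Countable N] : Module.Free ℤ N := by
  classical
  refine free_of_countable_of_exists_pure fun P hP => ?_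
  obtain ⟨s, rfl⟩ := hP
  obtain ⟨q, hq, hs⟩ := exists_common_denominator (φ := fun f : N => ((f : RX X) : RatFunField X)) s
    fun f => (f : RX X).2
  choose! a ha using hs
  have hq0 := hq.map_ne_zero
  let W := MvPolynomial.restrictSupport ℤ (↑(s.biUnion fun f => (a f).support) : Set (X →₀ ℕ))
  have hW : W.FG := Module.Finite.iff_fg.1
    (Module.Finite.of_basis (MvPolynomial.basisRestrictSupport ℤ _))
  let L : Submodule ℤ (RX X) := W.map (divLinear q hq)
  have hL : ∀ {f : RX X} {w}, w ∈ W → ι q * (f : RatFunField X) = ι w → f ∈ L := fun {f w} hw h =>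
    ⟨w, hw, Subtype.ext ((div_eq_iff hq0).2 (by rw [← h, mul_comm]))⟩
  have hLfg : L.FG := hW.map _
  refine ⟨L.comap N.subtype, ?_, ?_, ?_⟩
  · rw [Submodule.span_le]
    intro f hf
    refine hL ?_ (ha f hf)
    rw [MvPolynomial.mem_restrictSupport_iff]
    exact Finset.coe_subset.2 (Finset.subset_biUnion_of_mem (fun f => (a f).support) hf)
  · refine Submodule.fg_of_fg_map_injective N.subtype Subtype.val_injective ?_
    exact Submodule.FG.of_le hLfg (Submodule.map_comap_le _ _)
  · intro n g hn hg
    obtain ⟨w, hw, h⟩ := hg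
    have h' : ι w / ι q = n * ((g : RX X) : RatFunField X) := by
      simpa [divLinear] using congrArg (Subtype.val : RX X → RatFunField X) h
    obtain ⟨v, rfl, hv⟩ := exists_mul_eq_of_smul_mul_eq (g : RX X).2 hn (q := q) (w := w) (by
      rw [div_eq_iff hq0] at h'
      rw [h', zsmul_eq_mul]
      ring)
    refine hL ?_ hv
    rw [SetLike.mem_coe, MvPolynomial.mem_restrictSupport_iff] at hw
    rw [MvPolynomial.mem_restrictSupport_iff]
    refine subset_trans (fun m hm => ?_) hw
    rw [Finset.mem_coe, MvPolynomial.mem_support_iff] at hm ⊢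
    rw [MvPolynomial.coeff_C_mul]
    exact mul_ne_zero hn hm

end Ring

/-! ### Constant Laurent coefficients as additive retractions. -/

section ConstantCoeff

/-- Applying a ring homomorphism to the coefficients of a Laurent series. -/
noncomputable def laurentMap {L K : Type*} [Ring L] [Ring K] (φ : L →+* K) :
    LaurentSeries L →+* LaurentSeries K where
  toFun f := HahnSeries.map f φ
  map_one' := by
    ext n
    by_cases hn : n = 0 <;> simp [HahnSeries.coeff_one, hn]
  map_mul' f g := HahnSeries.map_mul (φ : L →ₙ+* K)
  map_zero' := by ext; simp
  map_add' f g := HahnSeries.map_add (φ : L →+ K)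

theorem mem_range_laurentMap {K : Type*} [Field K] (L : Subfield K) {f : LaurentSeries K} :
    f ∈ (laurentMap L.subtype).fieldRange ↔ ∀ n, f.coeff n ∈ L := by
  constructor
  · rintro ⟨g, rfl⟩ n
    exact (g.coeff n).2
  · intro h
    refine ⟨⟨fun n => ⟨f.coeff n, h n⟩, f.isPWO_support.mono fun n hn h0 => hn ?_⟩, ?_⟩
    · exact Subtype.ext h0
    · ext n
      rfl

variable {X : Type*} {k : Type*} [CommRing k]

local notation "κ" => algebraMap (MvPolynomial X k) (FractionRing (MvPolynomial X k))

open Classical in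
/-- A polynomial as a polynomial in the variable `x` over the field of rational functions. -/
noncomputable def singleOut (x : X) :
    MvPolynomial X k →+* Polynomial (FractionRing (MvPolynomial X k)) :=
  MvPolynomial.eval₂Hom ((Polynomial.C.comp κ).comp MvPolynomial.C) fun y =>
    if y = x then Polynomial.X else Polynomial.C (κ (MvPolynomial.X y))

/-- Substituting `x` back for the polynomial variable recovers the injective map `κ`. -/
theorem singleOut_injective (x : X) : Function.Injective (singleOut (k := k) x) := by
  have h : (Polynomial.evalRingHom (κ (MvPolynomial.X x))).comp (singleOut (k := k) x) = κ := by
    apply MvPolynomial.ringHom_ext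
    · intro a
      simp [singleOut]
    · intro y
      by_cases hy : y = x <;> simp [singleOut, hy]
  have hinj := IsFractionRing.injective (MvPolynomial X k) (FractionRing (MvPolynomial X k))
  rw [← h] at hinj
  exact Function.Injective.of_comp hinj

variable (k) [IsDomain k]

/-- The subfield of the rational functions in the variables from `T`. -/
noncomputable def varField (T : Set X) : Subfield (FractionRing (MvPolynomial X k)) :=
  Subfield.closure (κ ''
    (MvPolynomial.supported k T : Set (MvPolynomial X k)))

variable {k}

theorem varField_mono {T U : Set X} (h : T ⊆ U) : varField k T ≤ varField k U :=
  Subfield.closure_mono (Set.image_mono (MvPolynomial.supported_mono h))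

theorem algebraMap_mem_varField {T : Set X} {p : MvPolynomial X k}
    (hp : p ∈ MvPolynomial.supported k T) : κ p ∈ varField k T :=
  Subfield.subset_closure ⟨p, hp, rfl⟩

theorem mem_varField_iff {T : Set X} {f : FractionRing (MvPolynomial X k)} :
    f ∈ varField k T ↔ ∃ p ∈ MvPolynomial.supported k T, ∃ q ∈ MvPolynomial.supported k T,
      f = κ p / κ q := by
  have h : Subring.closure (κ ''
      (MvPolynomial.supported k T : Set (MvPolynomial X k))) =
        (MvPolynomial.supported k T).toSubring.map κ :=
    (RingHom.map_closure κ _).symm.trans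
      (congrArg _ (Subring.closure_eq (MvPolynomial.supported k T).toSubring))
  rw [varField, Subfield.mem_closure_iff, h]
  constructor
  · rintro ⟨_, ⟨p, hp, rfl⟩, _, ⟨q, hq, rfl⟩, rfl⟩
    exact ⟨p, hp, q, hq, rfl⟩
  · rintro ⟨p, hp, q, hq, rfl⟩
    exact ⟨_, ⟨p, hp, rfl⟩, _, ⟨q, hq, rfl⟩, rfl⟩

/-- To map the subfield `varField k T` by a ring homomorphism into a subfield it is enough to map
the constants and the variables. -/
theorem map_mem_of_mem_varField {K : Type*} [Field K] {T : Set X}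
    (φ : FractionRing (MvPolynomial X k) →+* K) (L : Subfield K)
    (hC : ∀ a, φ (κ (MvPolynomial.C a)) ∈ L)
    (hX : ∀ x ∈ T, φ (κ (MvPolynomial.X x)) ∈ L)
    {f : FractionRing (MvPolynomial X k)} (hf : f ∈ varField k T) : φ f ∈ L := by
  suffices h : varField k T ≤ L.comap φ from h hf
  refine Subfield.closure_le.2 ?_
  rintro _ ⟨p, hp, rfl⟩
  rw [SetLike.mem_coe, MvPolynomial.supported_eq_adjoin_X] at hp
  change φ (κ p) ∈ L
  induction hp using Algebra.adjoin_induction with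
  | mem p hp =>
    obtain ⟨x, hx, rfl⟩ := hp
    exact hX x hx
  | algebraMap a => exact hC a
  | add p q _ _ hp hq => rw [map_add, map_add]; exact add_mem hp hq
  | mul p q _ _ hp hq => rw [map_mul, map_mul]; exact mul_mem hp hq

/-- Two ring homomorphisms agree on `varField k T` if they agree on the constants and the
variables. -/
theorem eqOn_varField {K : Type*} [Field K] {T : Set X}
    (φ ψ : FractionRing (MvPolynomial X k) →+* K)
    (hC : ∀ a, φ (κ (MvPolynomial.C a)) = ψ (κ (MvPolynomial.C a)))
    (hX : ∀ x ∈ T, φ (κ (MvPolynomial.X x)) = ψ (κ (MvPolynomial.X x)))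
    {f : FractionRing (MvPolynomial X k)} (hf : f ∈ varField k T) : φ f = ψ f :=
  map_mem_of_mem_varField (RingHom.id _) (φ.eqLocusField ψ) hC hX hf

/-- The polynomials as Laurent polynomials. -/
noncomputable def polynomialToLaurent (K : Type*) [Field K] : Polynomial K →+* LaurentSeries K :=
  (HahnSeries.ofPowerSeries ℤ K).comp Polynomial.coeToPowerSeries.ringHom

theorem polynomialToLaurent_injective (K : Type*) [Field K] :
    Function.Injective (polynomialToLaurent K) :=
  HahnSeries.ofPowerSeries_injective.comp (Polynomial.coe_injective K)

/-- The Laurent expansion at `0` of a rational function in the variable `x`. -/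
noncomputable def laurentExpansion (x : X) :
    FractionRing (MvPolynomial X k) →+* LaurentSeries (FractionRing (MvPolynomial X k)) :=
  IsFractionRing.lift (A := MvPolynomial X k)
    (g := (polynomialToLaurent (FractionRing (MvPolynomial X k))).comp (singleOut x))
    ((polynomialToLaurent_injective _).comp (singleOut_injective x))

theorem laurentExpansion_C (x : X) (a : k) :
    laurentExpansion x (κ (MvPolynomial.C a)) =
      HahnSeries.C (κ (MvPolynomial.C a)) := by
  simp [laurentExpansion, IsFractionRing.lift_algebraMap, singleOut, polynomialToLaurent]

theorem laurentExpansion_X_self (x : X) :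
    laurentExpansion x (κ (MvPolynomial.X x)) =
      HahnSeries.single 1 1 := by
  simp [laurentExpansion, IsFractionRing.lift_algebraMap, singleOut, polynomialToLaurent]

theorem laurentExpansion_X_of_ne {x y : X} (h : y ≠ x) :
    laurentExpansion x (κ (MvPolynomial.X y)) =
      HahnSeries.C (κ (MvPolynomial.X y)) := by
  simp [laurentExpansion, IsFractionRing.lift_algebraMap, singleOut, polynomialToLaurent, h]

/-- The constant coefficient of the Laurent expansion in `x`. -/
noncomputable def constCoeff (x : X) :
    FractionRing (MvPolynomial X k) →+ FractionRing (MvPolynomial X k) :=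
  (HahnSeries.coeff.addMonoidHom (0 : ℤ)).comp (laurentExpansion x).toAddMonoidHom

theorem constCoeff_eq_self {x : X} {T : Set X} (hx : x ∉ T)
    {f : FractionRing (MvPolynomial X k)} (hf : f ∈ varField k T) : constCoeff x f = f := by
  have h : laurentExpansion x f = HahnSeries.C f :=
    eqOn_varField (laurentExpansion x) HahnSeries.C (laurentExpansion_C x)
      (fun y hy => laurentExpansion_X_of_ne (ne_of_mem_of_not_mem hy hx)) hf
  change (laurentExpansion x f).coeff 0 = f
  simp [h]

/-- All coefficients of the expansion lie in the smaller field. The series with this property form a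
subfield, so constants and variables suffice as a check. -/
theorem constCoeff_mem (x : X) {T : Set X} {f : FractionRing (MvPolynomial X k)}
    (hf : f ∈ varField k T) : constCoeff x f ∈ varField k (T \ {x}) := by
  refine (mem_range_laurentMap (varField k (T \ {x}))).1
    (map_mem_of_mem_varField (laurentExpansion x) _ (fun a => ?_) (fun y hy => ?_) hf) 0
  · rw [mem_range_laurentMap, laurentExpansion_C]
    intro n
    rw [HahnSeries.C_apply, HahnSeries.coeff_single]
    split_ifs
    · exact algebraMap_mem_varField (Subalgebra.algebraMap_mem _ a)
    · exact zero_mem _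
  · rw [mem_range_laurentMap]
    intro n
    by_cases h : y = x
    · subst h
      rw [laurentExpansion_X_self, HahnSeries.coeff_single]
      split_ifs
      · exact one_mem _
      · exact zero_mem _
    · rw [laurentExpansion_X_of_ne h, HahnSeries.C_apply, HahnSeries.coeff_single]
      split_ifs
      · exact algebraMap_mem_varField (Algebra.subset_adjoin ⟨y, ⟨hy, h⟩, rfl⟩)
      · exact zero_mem _

end ConstantCoeff

/-! ### Reduction modulo a prime, and purity. -/

section Reduction

variable {X : Type u}

local notation "ι" => algebraMap (MvPolynomial X ℤ) (RatFunField X)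

/-- The elements of `R_X` that are fractions in the variables from `T`, with a primitive
denominator. -/
noncomputable def varSubmodule (T : Set X) : Submodule ℤ (RX X) where
  carrier := {f | ∃ a ∈ MvPolynomial.supported ℤ T, ∃ q ∈ MvPolynomial.supported ℤ T,
    IsPrimitive q ∧ (f : RatFunField X) = ι a / ι q}
  zero_mem' := ⟨0, zero_mem _, 1, one_mem _, IsPrimitive.one, by simp⟩
  add_mem' := by
    rintro f g ⟨a, ha, q, hq, hq', hf⟩ ⟨b, hb, r, hr, hr', hg⟩
    refine ⟨a * r + q * b, add_mem (mul_mem ha hr) (mul_mem hq hb), q * r, mul_mem hq hr,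
      hq'.mul hr', ?_⟩
    rw [Subring.coe_add, hf, hg, map_add, map_mul, map_mul, map_mul,
      div_add_div _ _ hq'.map_ne_zero hr'.map_ne_zero]
  smul_mem' := by
    rintro n f ⟨a, ha, q, hq, hq', hf⟩
    refine ⟨n • a, Subalgebra.smul_mem _ ha n, q, hq, hq', ?_⟩
    simp [hf, mul_div_assoc]

theorem varSubmodule_mono {T U : Set X} (h : T ⊆ U) : varSubmodule T ≤ varSubmodule U := by
  rintro f ⟨a, ha, q, hq, hq', hf⟩
  exact ⟨a, MvPolynomial.supported_mono h ha, q, MvPolynomial.supported_mono h hq, hq', hf⟩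

theorem coe_mem_varField {T : Set X} {f : RX X} (hf : f ∈ varSubmodule T) :
    (f : RatFunField X) ∈ varField ℤ T := by
  obtain ⟨a, ha, q, hq, -, h⟩ := hf
  exact mem_varField_iff.2 ⟨a, ha, q, hq, h⟩

theorem exists_smul_eq_of_mem_varField {T : Set X} {f : RatFunField X} (hf : f ∈ varField ℤ T) :
    ∃ (n : ℤ) (g : RX X), n ≠ 0 ∧ g ∈ varSubmodule T ∧ (n : RatFunField X) * f = g := by
  obtain ⟨a, ha, b, hb, rfl⟩ := mem_varField_iff.1 hf
  rcases eq_or_ne b 0 with rfl | hb0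
  · exact ⟨1, 0, one_ne_zero, zero_mem _, by simp⟩
  obtain ⟨n, q, hn, hq, rfl⟩ := exists_eq_C_mul_isPrimitive hb0
  have hn' : (n : RatFunField X) ≠ 0 := Int.cast_ne_zero.2 hn
  refine ⟨n, ⟨ι a / ι q, a, q, hq, rfl⟩, hn,
    ⟨a, ha, q, mem_supported_of_C_mul_mem hn hb, hq, rfl⟩, ?_⟩
  have := hq.map_ne_zero
  simp only [map_mul, eq_intCast, map_intCast]
  field_simp

variable (p : ℕ) [Fact p.Prime]

local notation "𝔽" => FractionRing (MvPolynomial X (ZMod p))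
local notation "κ" => algebraMap (MvPolynomial X (ZMod p)) (FractionRing (MvPolynomial X (ZMod p)))
local notation "π" => MvPolynomial.map (σ := X) (Int.castRingHom (ZMod p))

theorem IsPrimitive.reduction_ne_zero {q : MvPolynomial X ℤ} (hq : IsPrimitive q) :
    κ (π q) ≠ 0 := by
  intro h
  have h0 : π q = 0 := IsFractionRing.injective (MvPolynomial X (ZMod p)) 𝔽
    (h.trans (map_zero _).symm)
  exact hq.not_C_dvd (Nat.prime_iff_prime_int.1 Fact.out)
    ((MvPolynomial.C_dvd_iff_zmod p q).2 h0)

/-- The residue modulo `p` of an element of `R_X`. -/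
noncomputable def residue (f : RX X) : 𝔽 :=
  κ (π (mem_RX.1 f.2).choose) / κ (π (mem_RX.1 f.2).choose_spec.choose)

theorem residue_eq {f : RX X} {a q : MvPolynomial X ℤ} (hq : IsPrimitive q)
    (h : (f : RatFunField X) = ι a / ι q) : residue p f = κ (π a) / κ (π q) := by
  obtain ⟨hr, hf⟩ := (mem_RX.1 f.2).choose_spec.choose_spec
  rw [residue, div_eq_div_iff (hr.reduction_ne_zero p) (hq.reduction_ne_zero p)]
  have hf' := h.symm.trans hf
  rw [div_eq_div_iff hq.map_ne_zero hr.map_ne_zero, ← map_mul, ← map_mul] at hf'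
  have := IsFractionRing.injective (MvPolynomial X ℤ) (RatFunField X) hf'
  rw [← map_mul, ← map_mul, ← map_mul, ← map_mul, this]

/-- Reduction modulo `p` as a ring homomorphism from `R_X` to the rational functions over the
prime field. -/
noncomputable def reduction : RX X →+* 𝔽 where
  toFun := residue p
  map_one' := by
    rw [residue_eq p IsPrimitive.one (a := 1) (by simp)]
    simp
  map_zero' := by
    rw [residue_eq p IsPrimitive.one (a := 0) (by simp)]
    simp
  map_mul' f g := by
    obtain ⟨a, q, hq, hf⟩ := mem_RX.1 f.2
    obtain ⟨b, r, hr, hg⟩ := mem_RX.1 g.2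
    rw [residue_eq p hq hf, residue_eq p hr hg, residue_eq p (hq.mul hr) (a := a * b) (by
      rw [Subring.coe_mul, hf, hg, map_mul, map_mul, div_mul_div_comm])]
    simp only [map_mul, div_mul_div_comm]
  map_add' f g := by
    obtain ⟨a, q, hq, hf⟩ := mem_RX.1 f.2
    obtain ⟨b, r, hr, hg⟩ := mem_RX.1 g.2
    rw [residue_eq p hq hf, residue_eq p hr hg,
      residue_eq p (hq.mul hr) (a := a * r + q * b) (by
        rw [Subring.coe_add, hf, hg, map_add, map_mul, map_mul, map_mul,
          div_add_div _ _ hq.map_ne_zero hr.map_ne_zero])]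
    rw [div_add_div _ _ (hq.reduction_ne_zero p) (hr.reduction_ne_zero p)]
    simp only [map_mul, map_add]

theorem reduction_eq {f : RX X} {a q : MvPolynomial X ℤ} (hq : IsPrimitive q)
    (h : (f : RatFunField X) = ι a / ι q) : reduction p f = κ (π a) / κ (π q) :=
  residue_eq p hq h

theorem map_mem_supported {T : Set X} {a : MvPolynomial X ℤ}
    (ha : a ∈ MvPolynomial.supported ℤ T) : π a ∈ MvPolynomial.supported (ZMod p) T := by
  rw [MvPolynomial.mem_supported] at ha ⊢
  exact (Finset.coe_subset.2 (MvPolynomial.vars_map _ _)).trans ha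

theorem exists_supported_map_eq {T : Set X} {a : MvPolynomial X (ZMod p)}
    (ha : a ∈ MvPolynomial.supported (ZMod p) T) : ∃ b ∈ MvPolynomial.supported ℤ T, π b = a := by
  rw [MvPolynomial.supported_eq_adjoin_X] at ha
  induction ha using Algebra.adjoin_induction with
  | mem a ha =>
    obtain ⟨x, hx, rfl⟩ := ha
    exact ⟨MvPolynomial.X x, MvPolynomial.X_mem_supported.2 hx, by simp⟩
  | algebraMap a =>
    obtain ⟨n, rfl⟩ := ZMod.intCast_surjective a
    exact ⟨MvPolynomial.C n, Subalgebra.algebraMap_mem _ n, by simp⟩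
  | add a b _ _ ha hb =>
    obtain ⟨a, ha, rfl⟩ := ha
    obtain ⟨b, hb, rfl⟩ := hb
    exact ⟨a + b, add_mem ha hb, by simp⟩
  | mul a b _ _ ha hb =>
    obtain ⟨a, ha, rfl⟩ := ha
    obtain ⟨b, hb, rfl⟩ := hb
    exact ⟨a * b, mul_mem ha hb, by simp⟩

theorem reduction_mem {T : Set X} {f : RX X} (hf : f ∈ varSubmodule T) :
    reduction p f ∈ varField (ZMod p) T := by
  obtain ⟨a, ha, q, hq, hq', h⟩ := hf
  exact mem_varField_iff.2 ⟨_, map_mem_supported p ha, _, map_mem_supported p hq,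
    reduction_eq p hq' h⟩

/-- A lifted denominator need not be primitive, but its content is a unit modulo `p`, so an integer
inverse `m` moves it to the numerator. -/
theorem exists_reduction_eq {T : Set X} {g : 𝔽} (hg : g ∈ varField (ZMod p) T) :
    ∃ f ∈ varSubmodule T, reduction p f = g := by
  obtain ⟨a, ha, b, hb, rfl⟩ := mem_varField_iff.1 hg
  rcases eq_or_ne b 0 with rfl | hb0
  · exact ⟨0, zero_mem _, by simp⟩
  obtain ⟨a, haT, rfl⟩ := exists_supported_map_eq p ha
  obtain ⟨b, hbT, rfl⟩ := exists_supported_map_eq p hb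
  obtain ⟨n, q, hn, hq, rfl⟩ := exists_eq_C_mul_isPrimitive (a := b)
    (by rintro rfl; exact hb0 (map_zero _))
  have hnp : (n : ZMod p) ≠ 0 := by
    intro h
    apply hb0
    rw [map_mul, MvPolynomial.map_C, eq_intCast, h, map_zero, zero_mul]
  obtain ⟨m, hm⟩ := ZMod.intCast_surjective (n : ZMod p)⁻¹
  refine ⟨⟨ι (MvPolynomial.C m * a) / ι q, _, q, hq, rfl⟩, ⟨_, mul_mem
    (Subalgebra.algebraMap_mem _ m) haT, q, mem_supported_of_C_mul_mem hn hbT, hq, rfl⟩, ?_⟩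
  rw [reduction_eq p hq rfl]
  have hmn : κ (π (MvPolynomial.C m)) * κ (π (MvPolynomial.C n)) = 1 := by
    rw [← map_mul, MvPolynomial.map_C, MvPolynomial.map_C, ← map_mul]
    simp [hm, hnp]
  have hn0 : κ (π (MvPolynomial.C n)) ≠ 0 := right_ne_zero_of_mul_eq_one hmn
  have hq0 := hq.reduction_ne_zero p
  rw [map_mul, map_mul, map_mul, map_mul, div_eq_div_iff hq0 (mul_ne_zero hn0 hq0)]
  linear_combination (κ (π a) * κ (π q)) * hmn

theorem exists_eq_smul_of_reduction_eq_zero {T : Set X} {f : RX X} (hf : f ∈ varSubmodule T)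
    (h0 : reduction p f = 0) : ∃ g ∈ varSubmodule T, f = (p : ℤ) • g := by
  obtain ⟨a, ha, q, hq, hq', h⟩ := hf
  rw [reduction_eq p hq' h, div_eq_zero_iff, or_iff_left (hq'.reduction_ne_zero p)] at h0
  have ha0 : π a = 0 := IsFractionRing.injective (MvPolynomial X (ZMod p)) 𝔽
    (h0.trans (map_zero _).symm)
  obtain ⟨b, rfl⟩ := (MvPolynomial.C_dvd_iff_zmod p a).2 ha0
  refine ⟨⟨ι b / ι q, b, q, hq', rfl⟩, ⟨b, mem_supported_of_C_mul_mem ?_ ha, q, hq, hq', rfl⟩,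
    Subtype.ext (h.trans ?_)⟩
  · exact_mod_cast (Fact.out : p.Prime).ne_zero
  · simp [mul_div_assoc]

theorem reduction_smul_self (f : RX X) : reduction p ((p : ℤ) • f) = 0 := by
  have : CharP 𝔽 p := by
    have : CharP (MvPolynomial X (ZMod p)) p := inferInstance
    exact IsFractionRing.charP (MvPolynomial X (ZMod p)) p
  simp

/-- Modulo `p` the sum vanishes, and so does its constant coefficient in `x`. This leaves the
residue of `h x` alone and removes `x` from the others; let `g y` lift the latter. Then `h x + ∑ g
y` is `p • w` with `w` free of `x`, and `p • (r - w)` is the sum of the `h y - g y` over the smaller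
set `J`. -/
theorem mem_iSup_of_prime_smul_eq_sum (S : Set X) (J : Finset X) : ∀ (h : X → RX X),
    (∀ x ∈ J, h x ∈ varSubmodule (S \ {x})) → ∀ r : RX X, (p : ℤ) • r = ∑ x ∈ J, h x →
      r ∈ ⨆ x ∈ J, varSubmodule (S \ {x}) := by
  classical
  have hp : (p : ℤ) ≠ 0 := by exact_mod_cast (Fact.out : p.Prime).ne_zero
  induction J using Finset.induction_on with
  | empty =>
    intro h _ r hr
    rw [Finset.sum_empty, smul_eq_zero] at hr
    rw [hr.resolve_left hp]
    exact zero_mem _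
  | insert x J hx ih =>
    intro h hh r hr
    rw [Finset.sum_insert hx] at hr
    have hJ : ∀ y ∈ J, ∃ g ∈ varSubmodule ((S \ {y}) \ {x}),
        reduction p g = constCoeff x (reduction p (h y)) := fun y hy =>
      exists_reduction_eq p (constCoeff_mem x (reduction_mem p (hh y (Finset.mem_insert_of_mem hy))))
    choose! g hg hgr using hJ
    have hxmem := hh x (Finset.mem_insert_self x J)
    have h0 : reduction p (h x + ∑ y ∈ J, g y) = 0 := by
      have h1 : reduction p (h x) = constCoeff x (reduction p (h x)) :=
        (constCoeff_eq_self (by simp) (reduction_mem p hxmem)).symm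
      rw [map_add, map_sum, Finset.sum_congr rfl hgr, h1, ← map_sum, ← map_sum, ← map_add,
        ← map_add, ← hr, reduction_smul_self, map_zero]
    have hmem : h x + ∑ y ∈ J, g y ∈ varSubmodule (S \ {x}) :=
      add_mem hxmem (sum_mem fun y hy => varSubmodule_mono
        (Set.sdiff_subset_sdiff_left Set.sdiff_subset) (hg y hy))
    obtain ⟨w, hw, hxw⟩ := exists_eq_smul_of_reduction_eq_zero p hmem h0
    have hrw := ih (fun y => h y - g y) (fun y hy => sub_mem (hh y (Finset.mem_insert_of_mem hy))
      (varSubmodule_mono Set.sdiff_subset (hg y hy))) (r - w) (by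
        rw [smul_sub, hr, ← hxw, Finset.sum_sub_distrib]
        abel)
    rw [Finset.iSup_insert]
    rw [← sub_add_cancel r w]
    exact add_mem (Submodule.mem_sup_right hrw) (Submodule.mem_sup_left hw)

end Reduction

theorem mem_iSup_of_smul_mem {X : Type u} (S : Set X) (J : Finset X) (n : ℤ) (hn : n ≠ 0)
    (r : RX X) (hr : n • r ∈ ⨆ x ∈ J, varSubmodule (S \ {x})) :
    r ∈ ⨆ x ∈ J, varSubmodule (S \ {x}) := by
  suffices h : ∀ (n : ℕ), n ≠ 0 → ∀ r : RX X, (n : ℤ) • r ∈ ⨆ x ∈ J, varSubmodule (S \ {x}) →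
      r ∈ ⨆ x ∈ J, varSubmodule (S \ {x}) by
    refine h n.natAbs (Int.natAbs_ne_zero.2 hn) r ?_
    rcases Int.natAbs_eq n with hn | hn <;> rw [hn] at hr
    · exact hr
    · rwa [neg_smul, neg_mem_iff] at hr
  intro n
  induction n using induction_on_primes with
  | zero => exact fun h => absurd rfl h
  | one => simp
  | prime_mul p n hp ih =>
    intro hpn r hr
    have : Fact p.Prime := ⟨hp⟩
    refine ih (right_ne_zero_of_mul hpn) r ?_
    rw [Nat.cast_mul, mul_smul] at hr
    obtain ⟨h, hsum⟩ := (Submodule.mem_iSup_finset_iff_exists_sum _ _).1 hr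
    exact mem_iSup_of_prime_smul_eq_sum p S J (fun x => h x) (fun x _ => (h x).2) _ hsum.symm

/-! ### Mixed differences, their kernels, and freeness of `R_X`. -/

section MixedDifference

variable {X : Type u}

local notation "ι" => algebraMap (MvPolynomial X ℤ) (RatFunField X)

/-- The action of a permutation of the variables on the rational functions. -/
noncomputable def renameField (e : Equiv.Perm X) : RatFunField X →+* RatFunField X :=
  IsFractionRing.lift (A := MvPolynomial X ℤ)
    (g := (ι).comp (MvPolynomial.rename e : MvPolynomial X ℤ →ₐ[ℤ] _).toRingHom)
    ((IsFractionRing.injective _ _).comp (MvPolynomial.rename_injective e e.injective))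

theorem renameField_algebraMap (e : Equiv.Perm X) (a : MvPolynomial X ℤ) :
    renameField e (ι a) = ι (MvPolynomial.rename e a) :=
  IsFractionRing.lift_algebraMap _ a

theorem renameField_mem (e : Equiv.Perm X) {T U : Set X} (h : Set.MapsTo e T U)
    {f : RatFunField X} (hf : f ∈ varField ℤ T) : renameField e f ∈ varField ℤ U := by
  refine map_mem_of_mem_varField (renameField e) _ (fun a => ?_) (fun x hx => ?_) hf
  · rw [renameField_algebraMap, MvPolynomial.rename_C]
    exact algebraMap_mem_varField (Subalgebra.algebraMap_mem _ a)
  · rw [renameField_algebraMap, MvPolynomial.rename_X]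
    exact algebraMap_mem_varField (Algebra.subset_adjoin ⟨_, h hx, rfl⟩)

theorem renameField_eq_self (e : Equiv.Perm X) {T : Set X} (h : ∀ x ∈ T, e x = x)
    {f : RatFunField X} (hf : f ∈ varField ℤ T) : renameField e f = f := by
  refine eqOn_varField (renameField e) (RingHom.id _) (fun a => ?_) (fun x hx => ?_) hf
  · rw [renameField_algebraMap, MvPolynomial.rename_C, RingHom.id_apply]
  · rw [renameField_algebraMap, MvPolynomial.rename_X, h x hx, RingHom.id_apply]

theorem renameField_mem_RX (e : Equiv.Perm X) {f : RatFunField X} (hf : f ∈ RX X) :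
    renameField e f ∈ RX X := by
  obtain ⟨a, q, hq, rfl⟩ := hf
  exact ⟨_, _, hq.rename e, by rw [map_div₀, renameField_algebraMap, renameField_algebraMap]⟩

/-- The action of a permutation of the variables on `R_X`. -/
noncomputable def renameRX (e : Equiv.Perm X) : RX X →+* RX X :=
  (renameField e).restrict (RX X) (RX X) fun _ => renameField_mem_RX e

open Classical in
/-- The mixed difference: the composite over the variables `x` from a list of the differences
`f ↦ f - f'`, where `f'` arises from `f` by exchanging `x` and `y x`. -/
noncomputable def mixedDiff (y : X → X) : List X → (RX X →ₗ[ℤ] RX X)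
  | [] => LinearMap.id
  | x :: l => (LinearMap.id - (renameRX (Equiv.swap x (y x))).toAddMonoidHom.toIntLinearMap).comp
      (mixedDiff y l)

open Classical in
theorem coe_mixedDiff_cons (y : X → X) (x : X) (l : List X) (f : RX X) :
    (mixedDiff y (x :: l) f : RatFunField X) = mixedDiff y l f -
      renameField (Equiv.swap x (y x)) (mixedDiff y l f) := rfl

theorem mixedDiff_mem_varField (y : X → X) (U : Set X) (f : RX X)
    (hf : (f : RatFunField X) ∈ varField ℤ U) (l : List X) (hl : ∀ x ∈ l, x ∈ U ∧ y x ∈ U) :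
    (mixedDiff y l f : RatFunField X) ∈ varField ℤ U := by
  classical
  induction l with
  | nil => exact hf
  | cons x l ih =>
    have h := ih fun z hz => hl z (List.mem_cons_of_mem x hz)
    obtain ⟨hx, hy⟩ := hl x List.mem_cons_self
    rw [coe_mixedDiff_cons]
    refine sub_mem h (renameField_mem _ (fun z hz => ?_) h)
    rw [Equiv.swap_apply_def]
    split_ifs <;> assumption

/-- The mixed difference vanishes on the functions that do not depend on one of the variables. -/
theorem mixedDiff_eq_zero {y : X → X} {x : X} {T : Set X} (hxT : x ∉ T) (hyT : y x ∉ T) {f : RX X}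
    (hf : (f : RatFunField X) ∈ varField ℤ T) (l : List X) (hxl : x ∈ l)
    (hinj : ∀ z ∈ l, y z = y x → z = x) (hne : ∀ z ∈ l, y z ≠ x ∧ z ≠ y x) :
    mixedDiff y l f = 0 := by
  classical
  have hTU : T ⊆ {x, y x}ᶜ := by
    rintro z hz (rfl | rfl)
    · exact hxT hz
    · exact hyT hz
  have hfU := varField_mono hTU hf
  induction l with
  | nil => simp at hxl
  | cons z l ih =>
    by_cases hx : x ∈ l
    · have h0 := ih hx (fun w hw => hinj w (List.mem_cons_of_mem z hw))
        (fun w hw => hne w (List.mem_cons_of_mem z hw))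
      exact Subtype.ext (by rw [coe_mixedDiff_cons, h0]; simp)
    · obtain rfl : x = z := by simpa [hx] using hxl
      refine Subtype.ext ?_
      have hU := mixedDiff_mem_varField y {x, y x}ᶜ f hfU l fun w hw => by
        have hwx : w ≠ x := by rintro rfl; exact hx hw
        have h1 := hne w (List.mem_cons_of_mem x hw)
        have h2 : y w ≠ y x := fun h => hwx (hinj w (List.mem_cons_of_mem x hw) h)
        exact ⟨by simp [hwx, h1.2], by simp [h1.1, h2]⟩
      rw [coe_mixedDiff_cons, renameField_eq_self _ (fun w hw => ?_) hU, sub_self]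
      · rfl
      · simp only [Set.mem_compl_iff, Set.mem_insert_iff, Set.mem_singleton_iff, not_or] at hw
        exact Equiv.swap_apply_of_ne_of_ne hw.1 hw.2

/-- Apart from `f` itself, every term in the expanded mixed difference has some `x` replaced by `y
x`. -/
theorem sub_mixedDiff_mem {y : X → X} {S Y : Set X} {f : RX X}
    (hf : (f : RatFunField X) ∈ varField ℤ S) (l : List X) (hl : l.Nodup)
    (hlS : ∀ x ∈ l, x ∈ S ∧ y x ∈ Y ∧ y x ∉ S) :
    (f : RatFunField X) - mixedDiff y l f ∈
      ⨆ x ∈ l, (varField ℤ ((S \ {x}) ∪ Y)).toSubring.toAddSubgroup := by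
  classical
  induction l with
  | nil => simp [mixedDiff]
  | cons x l ih =>
    rw [List.nodup_cons] at hl
    have h := ih hl.2 fun z hz => hlS z (List.mem_cons_of_mem x hz)
    obtain ⟨hxS, hyY, hyS⟩ := hlS x List.mem_cons_self
    set τ := renameField (Equiv.swap x (y x)) with hτ
    have hle : ⨆ z ∈ l, (varField ℤ ((S \ {z}) ∪ Y)).toSubring.toAddSubgroup ≤
        ⨆ z ∈ x :: l, (varField ℤ ((S \ {z}) ∪ Y)).toSubring.toAddSubgroup :=
      iSup₂_le fun z hz => le_iSup₂_of_le z (List.mem_cons_of_mem x hz) le_rfl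
    have hτle : ⨆ z ∈ l, (varField ℤ ((S \ {z}) ∪ Y)).toSubring.toAddSubgroup ≤
        (⨆ z ∈ l, (varField ℤ ((S \ {z}) ∪ Y)).toSubring.toAddSubgroup).comap
          τ.toAddMonoidHom := by
      refine iSup₂_le fun z hz g hg => ?_
      refine AddSubgroup.mem_iSup_of_mem z (AddSubgroup.mem_iSup_of_mem hz ?_)
      refine renameField_mem _ (fun w hw => ?_) hg
      rw [Equiv.swap_apply_def]
      split_ifs with h1 h2
      · exact Or.inr hyY
      · exact Or.inl ⟨hxS, fun hxz => hl.1 (Set.mem_singleton_iff.1 hxz ▸ hz)⟩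
      · exact hw
    have hτf : τ f ∈ ⨆ z ∈ x :: l, (varField ℤ ((S \ {z}) ∪ Y)).toSubring.toAddSubgroup := by
      refine AddSubgroup.mem_iSup_of_mem x (AddSubgroup.mem_iSup_of_mem List.mem_cons_self ?_)
      refine renameField_mem _ (fun w hw => ?_) hf
      rw [Equiv.swap_apply_def]
      split_ifs with h1 h2
      · exact Or.inr hyY
      · exact absurd (h2 ▸ hw) hyS
      · exact Or.inl ⟨hw, h1⟩
    have hkey : (f : RatFunField X) - mixedDiff y (x :: l) f =
        (f - mixedDiff y l f) + (τ f - τ (f - mixedDiff y l f)) := by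
      rw [coe_mixedDiff_cons, map_sub]
      ring
    rw [hkey]
    exact add_mem (hle h) (sub_mem hτf (hle (hτle h)))

/-- Compose the maps `constCoeff` over the variables in `Y`. -/
theorem exists_retraction (Y : Finset X) : ∃ c : RatFunField X →+ RatFunField X,
    (∀ T : Set X, Disjoint T Y → ∀ f ∈ varField ℤ T, c f = f) ∧
      ∀ (T : Set X), ∀ f ∈ varField ℤ T, c f ∈ varField ℤ (T \ Y) := by
  classical
  induction Y using Finset.induction_on with
  | empty => exact ⟨AddMonoidHom.id _, by simp, by simp⟩
  | insert y Y _ ih =>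
    obtain ⟨c, hc, hc'⟩ := ih
    refine ⟨(constCoeff y).comp c, fun T hT f hf => ?_, fun T f hf => ?_⟩
    · rw [Finset.coe_insert, Set.disjoint_insert_right] at hT
      rw [AddMonoidHom.comp_apply, hc T hT.2 f hf, constCoeff_eq_self hT.1 hf]
    · have := constCoeff_mem y (hc' T f hf)
      rwa [Set.sdiff_sdiff, Set.union_comm, ← Set.insert_eq, ← Finset.coe_insert] at this

/-- An element of `R_X` in the variables from `S` with zero mixed difference is a sum of elements
each of which depends on fewer variables. -/
theorem mem_iSup_of_mixedDiff_eq_zero {y : X → X} {S : Finset X} (hy : ∀ x ∈ S, y x ∉ S)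
    {f : RX X} (hf : f ∈ varSubmodule (S : Set X)) (h0 : mixedDiff y S.toList f = 0) :
    f ∈ ⨆ x ∈ S, varSubmodule ((S : Set X) \ {x}) := by
  classical
  obtain ⟨c, hc, hc'⟩ := exists_retraction (S.image y)
  have hfS := coe_mem_varField hf
  have h1 := sub_mixedDiff_mem (y := y) (Y := ↑(S.image y)) hfS S.toList S.nodup_toList
    fun x hx => by
      rw [Finset.mem_toList] at hx
      exact ⟨hx, Finset.mem_coe.2 (Finset.mem_image_of_mem y hx), hy x hx⟩
  rw [h0, ZeroMemClass.coe_zero, sub_zero] at h1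
  -- `B` is the rational saturation of the target sum; it absorbs the integer contents of
  -- denominators that appear after applying `c`.
  let B : AddSubgroup (RatFunField X) :=
    { carrier := {g | ∃ n : ℤ, n ≠ 0 ∧ ∃ r ∈ ⨆ x ∈ S, varSubmodule ((S : Set X) \ {x}),
        (n : RatFunField X) * g = (r : RX X)}
      zero_mem' := ⟨1, one_ne_zero, 0, zero_mem _, by simp⟩
      add_mem' := by
        rintro g g' ⟨n, hn, r, hr, h⟩ ⟨n', hn', r', hr', h'⟩
        refine ⟨n * n', mul_ne_zero hn hn', n' • r + n • r',
          add_mem (Submodule.smul_mem _ _ hr) (Submodule.smul_mem _ _ hr'), ?_⟩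
        simp only [Subring.coe_add, zsmul_eq_mul, Subring.coe_mul, Subring.coe_intCast, ← h, ← h']
        push_cast
        ring
      neg_mem' := by
        rintro g ⟨n, hn, r, hr, h⟩
        exact ⟨n, hn, -r, neg_mem hr, by simp [← h]⟩ }
  have hB : ⨆ x ∈ S.toList, (varField ℤ (((S : Set X) \ {x}) ∪ ↑(S.image y))).toSubring.toAddSubgroup
      ≤ B.comap c := by
    refine iSup₂_le fun x hx g hg => ?_
    have hg' := hc' _ g hg
    obtain ⟨n, r, hn, hr, h⟩ := exists_smul_eq_of_mem_varField hg'
    refine ⟨n, hn, r, Submodule.mem_iSup_of_mem x (Submodule.mem_iSup_of_mem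
      (Finset.mem_toList.1 hx) (varSubmodule_mono (fun z hz => ?_) hr)), h⟩
    exact hz.1.resolve_right hz.2
  -- The retraction fixes `f`, since the fresh variables lie outside `S`.
  have hcf : c f = f := hc _ (Set.disjoint_left.2 fun z hz hz' => by
    obtain ⟨x, hx, rfl⟩ := Finset.mem_image.1 (Finset.mem_coe.1 hz')
    exact hy x hx hz) _ hfS
  obtain ⟨n, hn, r, hr, h⟩ := hB h1
  rw [hcf] at h
  refine mem_iSup_of_smul_mem _ S n hn f ?_
  have : n • f = r := Subtype.ext (by simpa using h)
  rwa [this]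

theorem exists_fresh [Infinite X] (S F : Finset X) :
    ∃ y : X → X, Set.InjOn y S ∧ ∀ x ∈ S, y x ∉ F := by
  classical
  obtain ⟨t, ht, hcard⟩ := (F.finite_toSet.infinite_compl).exists_subset_card_eq S.card
  let e := Finset.equivOfCardEq hcard.symm
  refine ⟨fun x => if hx : x ∈ S then e ⟨x, hx⟩ else x, fun x hx z hz h => ?_, fun x hx => ?_⟩
  · rw [Finset.mem_coe] at hx hz
    simp only [hx, hz, dif_pos] at h
    exact congrArg Subtype.val (e.injective (Subtype.ext h))
  · simp only [hx, dif_pos]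
    exact ht (e ⟨x, hx⟩).2

theorem countable_varSubmodule (S : Finset X) : Countable (varSubmodule (S : Set X)) := by
  have hS : Countable (MvPolynomial (S : Set X) ℤ) := by
    rw [← Cardinal.mk_le_aleph0_iff]
    refine MvPolynomial.cardinalMk_le_max_lift.trans ?_
    simp
  have hc : Countable (MvPolynomial.supported ℤ (S : Set X)) :=
    (MvPolynomial.supportedEquivMvPolynomial (R := ℤ) (S : Set X)).injective.countable
  have hinj : Function.Injective fun f : varSubmodule (S : Set X) => (f : RatFunField X) :=
    Subtype.val_injective.comp Subtype.val_injective
  have hsub : Set.range (fun f : varSubmodule (S : Set X) => (f : RatFunField X)) ⊆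
      Set.range fun ab : MvPolynomial.supported ℤ (S : Set X) × MvPolynomial.supported ℤ (S : Set X) =>
        ι ab.1 / ι ab.2 := by
    rintro _ ⟨⟨f, a, ha, q, hq, -, h⟩, rfl⟩
    exact ⟨(⟨a, ha⟩, ⟨q, hq⟩), h.symm⟩
  have := ((Set.countable_range _).mono hsub).to_subtype
  exact (Set.rangeFactorization_injective.2 hinj).countable

theorem mixedDiff_toList_eq_zero {y : X → X} {S : Finset X} (hinj : Set.InjOn y S)
    (hy : ∀ x ∈ S, y x ∉ S) {T : Set X} (hST : ¬ (S : Set X) ⊆ T) (hyT : ∀ x ∈ S, y x ∉ T)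
    {f : RX X} (hf : f ∈ varSubmodule T) : mixedDiff y S.toList f = 0 := by
  obtain ⟨x, hx, hxT⟩ := Set.not_subset.1 hST
  refine mixedDiff_eq_zero hxT (hyT x hx) (coe_mem_varField hf) _ (Finset.mem_toList.2 hx)
    (fun z hz h => hinj (Finset.mem_toList.1 hz) hx h) fun z hz => ⟨?_, ?_⟩
  · rintro rfl
    exact hy z (Finset.mem_toList.1 hz) hx
  · rintro rfl
    exact hy x hx (Finset.mem_toList.1 hz)

theorem free_RX [Infinite X] : Module.Free ℤ (RX X) := by
  classical
  choose y hinj hy using fun S : Finset X => exists_fresh S S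
  have hfree : ∀ S : Finset X,
      Module.Free ℤ ((varSubmodule (S : Set X)).map (mixedDiff (y S) S.toList)) := fun S =>
    have := countable_varSubmodule S
    have : Countable ((varSubmodule (S : Set X)).map (mixedDiff (y S) S.toList)) :=
      (LinearMap.submoduleMap_surjective _ _).countable
    free_of_countable_submodule _
  choose C hCA hCfree hCdisj hCsup using fun S : Finset X =>
    exists_free_complement_ker (varSubmodule (S : Set X)) (mixedDiff (y S) S.toList) (hfree S)
  refine free_of_wellFounded_filtration (fun S : Finset X => varSubmodule (S : Set X)) C hCA
    (fun S => (hCsup S).trans (sup_le_sup_right ?_ _)) hCfree (fun S s hs => ?_) ?_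
  · rintro f ⟨hf, h0⟩
    have hle : ⨆ x ∈ S, varSubmodule ((S : Set X) \ {x}) ≤
        ⨆ T < S, varSubmodule ((T : Finset X) : Set X) := by
      refine iSup₂_le fun x hx => ?_
      rw [← Finset.coe_singleton, ← Finset.coe_sdiff, Finset.sdiff_singleton_eq_erase]
      exact le_iSup₂_of_le (S.erase x) (Finset.erase_ssubset hx) le_rfl
    exact hle (mem_iSup_of_mixedDiff_eq_zero (hy S) hf h0)
  · rw [Submodule.disjoint_def]
    intro f hfC hfs
    -- The fixed variables `y S` may occur in members of `s`; the new ones avoid all of them, so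
    -- this mixed difference kills the whole sum.
    obtain ⟨z, hzinj, hz⟩ := exists_fresh S (S ∪ s.sup id)
    have hzS : ∀ x ∈ S, z x ∉ S := fun x hx h => hz x hx (Finset.mem_union_left _ h)
    have hker : ⨆ T ∈ s, varSubmodule ((T : Finset X) : Set X) ≤
        LinearMap.ker (mixedDiff z S.toList) := iSup₂_le fun T hT g hg =>
      mixedDiff_toList_eq_zero hzinj hzS (fun h => hs T hT (Finset.coe_subset.1 h))
        (fun x hx h => hz x hx (Finset.mem_union_right _
          (Finset.le_sup (f := id) hT h))) hg
    have hf := mem_iSup_of_mixedDiff_eq_zero hzS (hCA S hfC) (hker hfs)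
    -- Back to the fixed choice `y S`, whose kernel is the one that `C S` avoids.
    have hle : ⨆ x ∈ S, varSubmodule ((S : Set X) \ {x}) ≤
        LinearMap.ker (mixedDiff (y S) S.toList) := iSup₂_le fun x hx g hg =>
      mixedDiff_toList_eq_zero (hinj S) (hy S) (fun h => (h hx).2 rfl)
        (fun w hw h => hy S w hw h.1) hg
    exact Submodule.disjoint_def.1 (hCdisj S) f hfC (hle hf)
  · refine top_le_iff.1 fun f _ => ?_
    obtain ⟨a, q, hq, h⟩ := mem_RX.1 f.2
    refine Submodule.mem_iSup_of_mem (a.vars ∪ q.vars) ⟨a, ?_, q, ?_, hq, h⟩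
    · exact MvPolynomial.mem_supported.2 (Finset.coe_subset.2 Finset.subset_union_left)
    · exact MvPolynomial.mem_supported.2 (Finset.coe_subset.2 Finset.subset_union_right)

end MixedDifference

end NoetherianFree

theorem mainTheorem1 (c : Cardinal.{u}) (hc : Cardinal.aleph0 ≤ c) :
    (∃ (R : Type u) (_ : CommRing R),
      IsDomain R ∧ IsNoetherianRing R ∧ Cardinal.mk R = c ∧ Module.Free ℤ R) ∧
    (∀ X : Type u, Cardinal.mk X = c →
      IsDomain (NoetherianFree.RX X) ∧ IsNoetherianRing (NoetherianFree.RX X) ∧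
        Cardinal.mk (NoetherianFree.RX X) = c ∧ Module.Free ℤ (NoetherianFree.RX X)) := by
  have h : ∀ X : Type u, Cardinal.mk X = c →
      IsDomain (NoetherianFree.RX X) ∧ IsNoetherianRing (NoetherianFree.RX X) ∧
        Cardinal.mk (NoetherianFree.RX X) = c ∧ Module.Free ℤ (NoetherianFree.RX X) := by
    rintro X rfl
    have : Infinite X := Cardinal.infinite_iff.2 hc
    exact ⟨inferInstance, NoetherianFree.isNoetherianRing_RX, NoetherianFree.mk_RX,
      NoetherianFree.free_RX⟩
  exact ⟨⟨NoetherianFree.RX c.out, inferInstance, h _ c.mk_out⟩, h⟩
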